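/- Let $q$ be a prime power, $\mathbf F_q$ the field with $q$ elements, and $C\ge 1$. Call an $\mathbf F_q$-valued random variable $\xi$ near uniform (with constant $C$) if $\mathbf P(\xi=a)\le C/q$ for every $a\in\mathbf F_q$. Let $Q_\infty$ be the random variable with values in $\{0,1,2,\dots\}$ and $$\mathbf P(Q_\infty=k)=\frac{1}{q^{k^2}}\,\frac{\prod_{i=k+1}^{\infty}(1-q^{-i})}{\prod_{i=1}^{k}(1-q^{-i})}\qquad(k\ge 0).$$ **Theorem 1.1.** For every $C\ge 1$ there are constants $c>0$ and $C'>0$, depending only on $C$, such that for every prime power $q$, every $n$, and every random $n\times n$ matrix $M_n$ over $\mathbf F_q$ whose $n^2$ entries are independent (not necessarily identically distributed) and near uniform with constant $C$, the corank $Q(M_n)=n-\operatorname{rank}(M_n)$ satisfies $$\|Q(M_n)-Q_\infty\|_{TV}\le\Big(\frac{C'}{q}\Big)^{cn},$$ where $\|X-Y\|_{TV}=\frac12\sum_{k\ge 0}|\mathbf P(X=k)-\mathbf P(Y=k)|$ is the total variation distance of the laws of $X$ and $Y$. -/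

import Mathlib

open MeasureTheory ProbabilityTheory Filter Topology

/-- The `q`-Pochhammer symbol `(x; x)_m = ∏_{i=1}^m (1 - x^i)`. -/
noncomputable def qPoch (x : ℝ) (m : ℕ) : ℝ := ∏ i ∈ Finset.range m, (1 - x ^ (i + 1))

/-- The infinite product `∏_{i ≥ k+1} (1 - x^i)`. -/
noncomputable def qPochTail (x : ℝ) (k : ℕ) : ℝ := ∏' i : ℕ, (1 - x ^ (k + i + 1))

/-- The point probabilities of the limiting corank variable,
`q^{-k^2} * ∏_{i ≥ k+1} (1 - q^{-i}) / ∏_{i=1}^k (1 - q^{-i})`. -/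
noncomputable def limitCorankProb (q k : ℕ) : ℝ :=
  1 / (q : ℝ) ^ (k ^ 2) *
    (qPochTail ((q : ℝ)⁻¹) k / qPoch ((q : ℝ)⁻¹) k)

section Helpers

theorem qPoch_succ (x : ℝ) (m : ℕ) : qPoch x (m + 1) = qPoch x m * (1 - x ^ (m + 1)) := by
  simp [qPoch, Finset.prod_range_succ]

theorem one_sub_pow_succ_pos {x : ℝ} (h0 : 0 < x) (h1 : x < 1) (i : ℕ) : 0 < 1 - x ^ (i + 1) := by
  have := pow_lt_one₀ h0.le h1 (Nat.succ_ne_zero i)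
  simpa using this

theorem qPoch_pos {x : ℝ} (h0 : 0 < x) (h1 : x < 1) (m : ℕ) : 0 < qPoch x m :=
  Finset.prod_pos fun i _ => one_sub_pow_succ_pos h0 h1 i

theorem summable_pow_succ {x : ℝ} (h0 : 0 < x) (h1 : x < 1) :
    Summable fun i : ℕ => ‖-x ^ (i + 1)‖ := by
  have := (summable_nat_add_iff 1).2 (summable_geometric_of_lt_one h0.le h1)
  refine this.congr fun i => ?_
  rw [norm_neg, Real.norm_of_nonneg (pow_nonneg h0.le _)]

theorem multipliable_qPoch {x : ℝ} (h0 : 0 < x) (h1 : x < 1) :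
    Multipliable fun i : ℕ => 1 - x ^ (i + 1) := by
  simpa [sub_eq_add_neg] using multipliable_one_add_of_summable (summable_pow_succ h0 h1)

theorem tendsto_qPoch {x : ℝ} (h0 : 0 < x) (h1 : x < 1) :
    Tendsto (qPoch x) atTop (𝓝 (qPochTail x 0)) := by
  have h := (multipliable_qPoch h0 h1).tendsto_prod_tprod_nat
  have e : qPochTail x 0 = ∏' i : ℕ, (1 - x ^ (i + 1)) := by simp [qPochTail]
  rw [e]
  exact h

theorem antitone_qPoch {x : ℝ} (h0 : 0 < x) (h1 : x < 1) : Antitone (qPoch x) := by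
  refine antitone_nat_of_succ_le fun m => ?_
  rw [qPoch_succ]
  have h := qPoch_pos h0 h1 m
  have := pow_pos h0 (m + 1)
  nlinarith

theorem qPochTail_zero_le {x : ℝ} (h0 : 0 < x) (h1 : x < 1) (m : ℕ) :
    qPochTail x 0 ≤ qPoch x m :=
  (antitone_qPoch h0 h1).le_of_tendsto (tendsto_qPoch h0 h1) m

theorem qPochTail_zero_pos {x : ℝ} (h0 : 0 < x) (h1 : x < 1) : 0 < qPochTail x 0 := by
  refine lt_of_le_of_ne (ge_of_tendsto' (tendsto_qPoch h0 h1) fun m => (qPoch_pos h0 h1 m).le) ?_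
  have h := tprod_one_add_ne_zero_of_summable (f := fun i : ℕ => -x ^ (i + 1))
    (fun i => by
      have := one_sub_pow_succ_pos h0 h1 i
      rw [← sub_eq_add_neg]; exact this.ne') (summable_pow_succ h0 h1)
  simpa [qPochTail, sub_eq_add_neg, eq_comm] using h

theorem qPoch_mul_qPochTail {x : ℝ} (h0 : 0 < x) (h1 : x < 1) (k : ℕ) :
    qPoch x k * qPochTail x k = qPochTail x 0 := by
  have hs : Multipliable fun i : ℕ => 1 - x ^ (i + k + 1) := by
    have : Summable fun i : ℕ => ‖-x ^ (i + k + 1)‖ :=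
      (summable_nat_add_iff (f := fun i : ℕ => ‖-x ^ (i + 1)‖) k).2 (summable_pow_succ h0 h1)
    simpa [sub_eq_add_neg] using multipliable_one_add_of_summable this
  have := Multipliable.prod_mul_tprod_nat_mul' (f := fun i : ℕ => 1 - x ^ (i + 1)) hs
  simpa [qPoch, qPochTail, add_comm, add_left_comm] using this

/-- The summand of the identity `∑_k x^{k(k+m)} / ((x)_k (x)_{k+m}) = 1 / (x)_∞`. -/
noncomputable def durfeeTerm (x : ℝ) (m k : ℕ) : ℝ :=
  x ^ (k * (k + m)) / (qPoch x k * qPoch x (k + m))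

theorem durfeeTerm_nonneg {x : ℝ} (h0 : 0 < x) (h1 : x < 1) (m k : ℕ) : 0 ≤ durfeeTerm x m k :=
  div_nonneg (pow_nonneg h0.le _) (mul_pos (qPoch_pos h0 h1 _) (qPoch_pos h0 h1 _)).le

theorem durfeeTerm_le {x : ℝ} (h0 : 0 < x) (h1 : x < 1) (m k : ℕ) :
    durfeeTerm x m k ≤ x ^ k / (qPochTail x 0 * qPochTail x 0) := by
  have hp := qPochTail_zero_pos h0 h1
  have h2 := qPochTail_zero_le h0 h1 k
  have h3 := qPochTail_zero_le h0 h1 (k + m)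
  have h4 : x ^ (k * (k + m)) ≤ x ^ k := by
    refine pow_le_pow_of_le_one h0.le h1.le ?_
    rcases Nat.eq_zero_or_pos k with rfl | hk
    · simp
    · exact Nat.le_mul_of_pos_right k (by omega)
  have h5 := qPoch_pos h0 h1 k
  unfold durfeeTerm
  gcongr

theorem summable_durfeeBound {x : ℝ} (h0 : 0 < x) (h1 : x < 1) :
    Summable fun k : ℕ => x ^ k / (qPochTail x 0 * qPochTail x 0) :=
  (summable_geometric_of_lt_one h0.le h1).div_const _

theorem summable_durfeeTerm {x : ℝ} (h0 : 0 < x) (h1 : x < 1) (m : ℕ) :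
    Summable (durfeeTerm x m) :=
  Summable.of_nonneg_of_le (durfeeTerm_nonneg h0 h1 m) (durfeeTerm_le h0 h1 m)
    (summable_durfeeBound h0 h1)

theorem durfeeTerm_sub {x : ℝ} (h0 : 0 < x) (h1 : x < 1) (m k : ℕ) :
    durfeeTerm x m k - durfeeTerm x (m + 1) k =
      (1 - x ^ k) * x ^ (k * (k + m)) / (qPoch x k * qPoch x (k + m)) -
      (1 - x ^ (k + 1)) * x ^ ((k + 1) * (k + 1 + m)) /
        (qPoch x (k + 1) * qPoch x (k + 1 + m)) := by
  have e1 : k + 1 + m = (k + m) + 1 := by ring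
  have e2 : k + (m + 1) = (k + m) + 1 := by ring
  have a1 := (qPoch_pos h0 h1 k).ne'
  have a2 := (qPoch_pos h0 h1 (k + m)).ne'
  have a3 := (one_sub_pow_succ_pos h0 h1 k).ne'
  have a4 := (one_sub_pow_succ_pos h0 h1 (k + m)).ne'
  have p1 : x ^ ((k + 1) * (k + m + 1)) = x ^ (k * (k + m)) * x ^ k * x ^ (k + m + 1) := by
    rw [← pow_add, ← pow_add]; congr 1; ring
  have p2 : x ^ (k * (k + m + 1)) = x ^ (k * (k + m)) * x ^ k := by
    rw [← pow_add]; congr 1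
  unfold durfeeTerm
  rw [e1, e2, qPoch_succ, qPoch_succ, p1, p2]
  generalize x ^ (k + m + 1) = u at *
  generalize x ^ (k + 1) = v at *
  generalize x ^ (k * (k + m)) = w at *
  generalize x ^ k = y at *
  field_simp
  ring

theorem tsum_durfeeTerm_succ {x : ℝ} (h0 : 0 < x) (h1 : x < 1) (m : ℕ) :
    ∑' k, durfeeTerm x m k = ∑' k, durfeeTerm x (m + 1) k := by
  have hs := (summable_durfeeTerm h0 h1 m).hasSum.sub (summable_durfeeTerm h0 h1 (m + 1)).hasSum
  have ht := hs.tendsto_sum_nat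
  set B : ℕ → ℝ := fun k =>
    (1 - x ^ k) * x ^ (k * (k + m)) / (qPoch x k * qPoch x (k + m)) with hB
  have hsum : ∀ n, ∑ k ∈ Finset.range n, (durfeeTerm x m k - durfeeTerm x (m + 1) k) = - B n := by
    intro n
    have : ∀ k, durfeeTerm x m k - durfeeTerm x (m + 1) k = B k - B (k + 1) :=
      fun k => durfeeTerm_sub h0 h1 m k
    simp_rw [this]
    rw [Finset.sum_range_sub']
    simp [hB]
  have hB0 : Tendsto B atTop (𝓝 0) := by
    refine squeeze_zero (fun k => ?_) (fun k => ?_) (summable_durfeeTerm h0 h1 m).tendsto_atTop_zero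
    · have : 0 ≤ 1 - x ^ k := sub_nonneg.2 (pow_le_one₀ h0.le h1.le)
      exact div_nonneg (mul_nonneg this (pow_nonneg h0.le _))
        (mul_pos (qPoch_pos h0 h1 _) (qPoch_pos h0 h1 _)).le
    · have hx : 0 ≤ x ^ k := pow_nonneg h0.le _
      have := durfeeTerm_nonneg h0 h1 m k
      have e : B k = (1 - x ^ k) * durfeeTerm x m k := by
        simp only [hB, durfeeTerm]; ring
      rw [e]
      nlinarith
  simp_rw [hsum] at ht
  have := tendsto_nhds_unique ht hB0.neg
  linarith

theorem hasSum_durfeeTerm {x : ℝ} (h0 : 0 < x) (h1 : x < 1) :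
    HasSum (durfeeTerm x 0) (qPochTail x 0)⁻¹ := by
  have hp := qPochTail_zero_pos h0 h1
  have hconst : ∀ m, ∑' k, durfeeTerm x m k = ∑' k, durfeeTerm x 0 k := by
    intro m
    induction m with
    | zero => rfl
    | succ m ih => rw [← tsum_durfeeTerm_succ h0 h1 m, ih]
  have hlim : Tendsto (fun m => ∑' k, durfeeTerm x m k) atTop
      (𝓝 (∑' k : ℕ, if k = 0 then (qPochTail x 0)⁻¹ else 0)) := by
    refine tendsto_tsum_of_dominated_convergence (summable_durfeeBound h0 h1) (fun k => ?_)
      (Eventually.of_forall fun m k => ?_)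
    · have hq : Tendsto (fun m => qPoch x (k + m)) atTop (𝓝 (qPochTail x 0)) := by
        simpa [add_comm] using (tendsto_add_atTop_iff_nat k).2 (tendsto_qPoch h0 h1)
      rcases Nat.eq_zero_or_pos k with rfl | hk
      · have h00 : qPoch x 0 = 1 := by simp [qPoch]
        simpa [durfeeTerm, h00] using hq.inv₀ hp.ne'
      · have hx : Tendsto (fun m => x ^ (k * (k + m))) atTop (𝓝 0) := by
          refine (tendsto_pow_atTop_nhds_zero_of_lt_one h0.le h1).comp ?_
          refine tendsto_atTop_mono (fun m => ?_) tendsto_id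
          simp only [id]
          nlinarith
        have := hx.div (hq.const_mul (qPoch x k)) (mul_pos (qPoch_pos h0 h1 k) hp).ne'
        simp only [zero_div] at this
        rw [if_neg hk.ne']
        exact this
    · rw [Real.norm_of_nonneg (durfeeTerm_nonneg h0 h1 m k)]
      exact durfeeTerm_le h0 h1 m k
  simp_rw [hconst] at hlim
  rw [tsum_ite_eq] at hlim
  rw [← tendsto_nhds_unique tendsto_const_nhds hlim]
  exact (summable_durfeeTerm h0 h1 0).hasSum

theorem limitCorankProb_nonneg {q : ℕ} (hq : 1 < q) (k : ℕ) : 0 ≤ limitCorankProb q k := by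
  have hq' : (1 : ℝ) < q := by exact_mod_cast hq
  have h0 : 0 < (q : ℝ)⁻¹ := by positivity
  have h1 : (q : ℝ)⁻¹ < 1 := inv_lt_one_of_one_lt₀ hq'
  have hP := qPoch_pos h0 h1 k
  have hT : 0 < qPochTail ((q : ℝ)⁻¹) k :=
    (mul_pos_iff_of_pos_left hP).1 (by
      rw [qPoch_mul_qPochTail h0 h1 k]; exact qPochTail_zero_pos h0 h1)
  unfold limitCorankProb
  positivity

theorem hasSum_limitCorankProb {q : ℕ} (hq : 1 < q) : HasSum (limitCorankProb q) 1 := by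
  have hq' : (1 : ℝ) < q := by exact_mod_cast hq
  have h0 : 0 < (q : ℝ)⁻¹ := by positivity
  have h1 : (q : ℝ)⁻¹ < 1 := inv_lt_one_of_one_lt₀ hq'
  have h := (hasSum_durfeeTerm h0 h1).mul_left (qPochTail ((q : ℝ)⁻¹) 0)
  rw [mul_inv_cancel₀ (qPochTail_zero_pos h0 h1).ne'] at h
  have e : limitCorankProb q =
      fun k => qPochTail ((q : ℝ)⁻¹) 0 * durfeeTerm ((q : ℝ)⁻¹) 0 k := by
    funext k
    have hP := (qPoch_pos h0 h1 k).ne'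
    rw [← qPoch_mul_qPochTail h0 h1 k]
    simp only [limitCorankProb, durfeeTerm, add_zero, inv_pow, one_div, pow_two]
    field_simp
  rw [e]
  exact h

end Helpers

/-- The law of the limiting corank variable `Q_∞` attached to `q > 1`. -/
noncomputable def limitCorankPMF (q : ℕ) (hq : 1 < q) : PMF ℕ :=
  ⟨fun k => ENNReal.ofReal (limitCorankProb q k), by
    have h := (hasSum_limitCorankProb hq)
    have h3 := ENNReal.ofReal_tsum_of_nonneg (limitCorankProb_nonneg hq) h.summable
    rw [h.tsum_eq, ENNReal.ofReal_one] at h3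
    rw [h3]
    exact ENNReal.summable.hasSum⟩

/-- Total variation distance of two finite measures on `ℕ`. -/
noncomputable def tvDist (μ ν : Measure ℕ) : ℝ :=
  (1 / 2) * ∑' k : ℕ, |μ.real {k} - ν.real {k}|

/-- An `F`-valued random variable is near uniform with constant `C` when it takes each value
with probability at most `C / q`, where `q` is the cardinality of `F`. -/
def IsNearUniform {F Ω : Type*} [Fintype F] [MeasurableSpace Ω] (μ : Measure Ω) (C : ℝ)
    (ξ : Ω → F) : Prop :=
  ∀ a : F, μ.real {ω | ξ ω = a} ≤ C / (Fintype.card F : ℝ)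

/-- The corank of a square matrix. -/
noncomputable def corank {F : Type*} [Field F] {n : ℕ} (A : Matrix (Fin n) (Fin n) F) : ℕ :=
  n - A.rank

/-! The rows are exposed one at a time, and the common kernel `U` of the first `k` rows is followed.
A new row either annihilates `U`, leaving its dimension unchanged, or lowers that dimension by one.
For uniform rows the first case has probability exactly `q ^ (-dim U)`, so the dimension is a Markov
chain with an explicit law at time `n`, which is within `O(q ^ (-n))` of the limiting law.

For near uniform rows, Fourier inversion on `U` shows that the annihilation probability differs from
`q ^ (-dim U)` by at most `q ^ (-dim U)` times the sum over nonzero `y` in `U` of the absolute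
Fourier coefficients of the new row. This may be large for a particular `U`, but only its average
matters: a fixed `y ≠ 0` lies in `U` with probability at most `(C / q) ^ k`, the coefficients sum
over all `y` to at most `√(C q) ^ n`, and `dim U ≥ n - k`. Hence each step costs at most `√(C ^ 3 /
q) ^ n` on average (`rowExp_abs_annihilateProb_sub_le`). The uniform chain does not expand `ℓ¹`
distances, so the errors of the `n` steps merely add up (`sum_abs_nullityLaw_sub_succ_le`), and the
factor `n` is absorbed in the constant. -/

/-- A probability vector on `F` all of whose entries are at most `C / |F|`. -/
structure NearUniformWeight {F : Type*} [Fintype F] (C : ℝ) (p : F → ℝ) : Prop where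
  nonneg : ∀ a, 0 ≤ p a
  sum_eq_one : ∑ a, p a = 1
  le : ∀ a, p a ≤ C / (Fintype.card F : ℝ)

/-- The product weight on `ι → F` with marginals `p j`. -/
def prodWeight {ι F : Type*} [Fintype ι] (p : ι → F → ℝ) (v : ι → F) : ℝ := ∏ j, p j (v j)

/-- The Fourier transform of a weight on a finite field. -/
noncomputable def weightFourier {F : Type*} [Field F] [Fintype F] (ψ : AddChar F ℂ) (p : F → ℝ)
    (s : F) : ℂ := ∑ a, (p a : ℂ) * ψ (s * a)

/-! ### Fourier analysis of near uniform weights on `F` and `F ^ n`. -/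

section Fourier

variable {F : Type*} [Fintype F] {C : ℝ} {n : ℕ}

theorem prodWeight_nonneg {ι : Type*} [Fintype ι] {p : ι → F → ℝ}
    (hp : ∀ j, NearUniformWeight C (p j)) (v : ι → F) : 0 ≤ prodWeight p v :=
  Finset.prod_nonneg fun j _ => (hp j).nonneg _

theorem sum_prodWeight {ι : Type*} [Fintype ι] [DecidableEq ι] {p : ι → F → ℝ}
    (hp : ∀ j, NearUniformWeight C (p j)) : ∑ v, prodWeight p v = 1 := by
  have h := Finset.prod_univ_sum (fun _ : ι => (Finset.univ : Finset F)) p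
  rw [Fintype.piFinset_univ] at h
  simp only [prodWeight]
  rw [← h]
  exact Finset.prod_eq_one fun j _ => (hp j).sum_eq_one

variable [Field F]

theorem exists_isPrimitive_addChar (F : Type*) [Field F] [Fintype F] :
    ∃ ψ : AddChar F ℂ, ψ.IsPrimitive :=
  ⟨_, AddChar.FiniteField.primitiveChar_to_Complex_isPrimitive F⟩

theorem sum_weightFourier_mul_conj {ψ : AddChar F ℂ} (hψ : ψ.IsPrimitive) (p : F → ℝ) :
    ∑ s, weightFourier ψ p s * (starRingEnd ℂ) (weightFourier ψ p s) =
      (Fintype.card F : ℂ) * ∑ a, (p a : ℂ) ^ 2 := by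
  classical
  have h1 : ∀ s, weightFourier ψ p s * (starRingEnd ℂ) (weightFourier ψ p s) =
      ∑ a, ∑ b, (p a : ℂ) * p b * ψ (s * (a - b)) := by
    intro s
    simp only [weightFourier, map_sum, map_mul, Complex.conj_ofReal, Finset.sum_mul_sum,
      ← AddChar.map_neg_eq_conj]
    refine Finset.sum_congr rfl fun a _ => Finset.sum_congr rfl fun b _ => ?_
    rw [mul_sub, sub_eq_add_neg, AddChar.map_add_eq_mul]
    ring
  simp_rw [h1]
  rw [Finset.sum_comm, Finset.mul_sum]
  refine Finset.sum_congr rfl fun a _ => ?_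
  rw [Finset.sum_comm]
  simp_rw [← Finset.mul_sum, AddChar.sum_mulShift _ hψ, sub_eq_zero]
  rw [Finset.sum_eq_single a]
  · simp; ring
  · intro b _ hb
    simp [hb.symm]
  · simp

theorem sum_norm_sq_weightFourier {ψ : AddChar F ℂ} (hψ : ψ.IsPrimitive) (p : F → ℝ) :
    ∑ s, ‖weightFourier ψ p s‖ ^ 2 = (Fintype.card F : ℝ) * ∑ a, p a ^ 2 := by
  have h := sum_weightFourier_mul_conj hψ p
  simp_rw [Complex.mul_conj'] at h
  exact_mod_cast h

/-- Cauchy–Schwarz over the `q` frequencies, then Parseval, then `∑ p² ≤ max p ≤ C / q`. -/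
theorem sum_norm_weightFourier_le {ψ : AddChar F ℂ} (hψ : ψ.IsPrimitive) {p : F → ℝ}
    (hp : NearUniformWeight C p) :
    ∑ s, ‖weightFourier ψ p s‖ ≤ √(C * Fintype.card F) := by
  have hq : (0 : ℝ) < Fintype.card F := by exact_mod_cast Fintype.card_pos
  refine Real.le_sqrt_of_sq_le ?_
  have h1 : ∑ a, p a ^ 2 ≤ C / Fintype.card F := by
    calc ∑ a, p a ^ 2 ≤ ∑ a, C / Fintype.card F * p a :=
          Finset.sum_le_sum fun a _ => by
            rw [sq]; exact mul_le_mul_of_nonneg_right (hp.le a) (hp.nonneg a)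
      _ = _ := by rw [← Finset.mul_sum, hp.sum_eq_one, mul_one]
  calc (∑ s, ‖weightFourier ψ p s‖) ^ 2
      ≤ (Finset.univ : Finset F).card * ∑ s, ‖weightFourier ψ p s‖ ^ 2 := sq_sum_le_card_mul_sum_sq
    _ = Fintype.card F * (Fintype.card F * ∑ a, p a ^ 2) := by
        rw [sum_norm_sq_weightFourier hψ, Finset.card_univ]
    _ ≤ Fintype.card F * (Fintype.card F * (C / Fintype.card F)) := by gcongr
    _ = C * Fintype.card F := by field_simp

theorem sum_prodWeight_mul_addChar (ψ : AddChar F ℂ) (p : Fin n → F → ℝ) (x : Fin n → F) :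
    ∑ v, (prodWeight p v : ℂ) * ψ (x ⬝ᵥ v) = ∏ j, weightFourier ψ (p j) (x j) := by
  have h := Finset.prod_univ_sum (fun _ : Fin n => (Finset.univ : Finset F))
    fun j a => (p j a : ℂ) * ψ (x j * a)
  rw [Fintype.piFinset_univ] at h
  simp only [weightFourier]
  rw [h]
  refine Finset.sum_congr rfl fun v _ => ?_
  rw [Finset.prod_mul_distrib, prodWeight, Complex.ofReal_prod]
  congr 1
  exact map_prod ψ.toMonoidHom (fun j => Multiplicative.ofAdd (x j * v j)) Finset.univ

theorem sum_prod_norm_weightFourier_le {ψ : AddChar F ℂ} (hψ : ψ.IsPrimitive) {p : Fin n → F → ℝ}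
    (hp : ∀ j, NearUniformWeight C (p j)) :
    ∑ x : Fin n → F, ∏ j, ‖weightFourier ψ (p j) (x j)‖ ≤ √(C * Fintype.card F) ^ n := by
  have h := Finset.prod_univ_sum (fun _ : Fin n => (Finset.univ : Finset F))
    fun j a => ‖weightFourier ψ (p j) a‖
  rw [Fintype.piFinset_univ] at h
  rw [← h]
  calc _ ≤ ∏ _j : Fin n, √(C * Fintype.card F) :=
        Finset.prod_le_prod (fun j _ => Finset.sum_nonneg fun _ _ => norm_nonneg _)
          fun j _ => sum_norm_weightFourier_le hψ (hp j)
    _ = _ := by simp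

-- The map `x ↦ ψ (x ⬝ᵥ v)` is a character of the group `U`. If some `y ∈ U` has `y ⬝ᵥ v ≠ 0`, the
-- multiples of `y` make `x ⬝ᵥ v` take every value of `F`, so this character is nontrivial and sums
-- to zero.
open Classical in
theorem sum_addChar_dotProduct {ψ : AddChar F ℂ} (hψ : ψ.IsPrimitive)
    (U : Submodule F (Fin n → F)) (v : Fin n → F) :
    ∑ x : U, ψ ((x : Fin n → F) ⬝ᵥ v) =
      if ∀ x ∈ U, x ⬝ᵥ v = 0 then (Fintype.card U : ℂ) else 0 := by
  split_ifs with h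
  · simp [h]
  · push Not at h
    obtain ⟨y, hy, hyv⟩ := h
    let χ : AddChar U ℂ :=
      { toFun := fun x => ψ ((x : Fin n → F) ⬝ᵥ v)
        map_zero_eq_one' := by simp
        map_add_eq_mul' := fun a b => by simp [add_dotProduct, AddChar.map_add_eq_mul] }
    have hχ : χ ≠ 1 := by
      intro h1
      obtain ⟨b, hb⟩ := AddChar.ne_one_iff.1 (by
        have := hψ one_ne_zero
        rwa [AddChar.mulShift_one] at this)
      apply hb
      have h2 : χ ⟨(b / (y ⬝ᵥ v)) • y, U.smul_mem _ hy⟩ = 1 := by rw [h1]; rfl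
      have h3 : ((b / (y ⬝ᵥ v)) • y) ⬝ᵥ v = b := by
        rw [smul_dotProduct, smul_eq_mul, div_mul_cancel₀ _ hyv]
      rw [← h3]
      exact h2
    exact AddChar.sum_eq_zero_of_ne_one hχ

open Classical in
/-- The probability that a random vector annihilates `U` is close to `|U|⁻¹`, up to the Fourier
coefficients supported on `U`. -/
theorem abs_sum_prodWeight_annihilates_sub_le {ψ : AddChar F ℂ} (hψ : ψ.IsPrimitive)
    {p : Fin n → F → ℝ} (hp : ∀ j, NearUniformWeight C (p j)) (U : Submodule F (Fin n → F)) :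
    |∑ v, prodWeight p v * (if ∀ x ∈ U, x ⬝ᵥ v = 0 then 1 else 0) -
        ((Fintype.card F : ℝ)⁻¹) ^ Module.finrank F U| ≤
      ((Fintype.card F : ℝ)⁻¹) ^ Module.finrank F U *
        ∑ x : Fin n → F, (if x ∈ U ∧ x ≠ 0 then ∏ j, ‖weightFourier ψ (p j) (x j)‖ else 0) := by
  set Q : ℝ := ((Fintype.card F : ℝ)⁻¹) ^ Module.finrank F U with hQ
  set φ : (Fin n → F) → ℂ := fun x => ∏ j, weightFourier ψ (p j) (x j) with hφ
  have hcard : (Fintype.card U : ℝ) = (Fintype.card F : ℝ) ^ Module.finrank F U := by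
    exact_mod_cast Module.card_eq_pow_finrank (K := F) (V := U)
  have hq : (0 : ℝ) < Fintype.card F := by exact_mod_cast Fintype.card_pos
  have hQU : Q * Fintype.card U = 1 := by
    rw [hcard, hQ, ← mul_pow, inv_mul_cancel₀ hq.ne', one_pow]
  have hQ0 : 0 ≤ Q := by positivity
  have hφ0 : φ 0 = 1 := by
    have h1 : ∀ j, weightFourier ψ (p j) 0 = 1 := fun j => by
      have := (hp j).sum_eq_one
      simp only [weightFourier, zero_mul, AddChar.map_zero_eq_one, mul_one]
      exact_mod_cast this
    simp [hφ, h1]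
  -- The indicator of annihilating `U` is the average of `ψ (x ⬝ᵥ v)` over `x ∈ U`. The probability
  -- is therefore the average over `U` of the Fourier transform `φ`, whose value `φ 0 = 1` produces
  -- the main term.
  have h1 : (((∑ v, prodWeight p v * (if ∀ x ∈ U, x ⬝ᵥ v = 0 then 1 else 0) : ℝ)) : ℂ) =
      Q * ∑ x : U, φ x := by
    simp only [hφ, ← sum_prodWeight_mul_addChar]
    rw [Finset.sum_comm]
    simp_rw [← Finset.mul_sum, sum_addChar_dotProduct hψ]
    rw [Complex.ofReal_sum, Finset.mul_sum]
    refine Finset.sum_congr rfl fun v _ => ?_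
    split_ifs
    · rw [mul_left_comm]
      have : (Q : ℂ) * (Fintype.card U : ℂ) = 1 := by exact_mod_cast hQU
      rw [this]; simp
    · simp
  have h2 : (∑ x : U, φ x) = 1 + ∑ x : Fin n → F, (if x ∈ U ∧ x ≠ 0 then φ x else 0) := by
    have e1 : (∑ x : U, φ x) = ∑ x : Fin n → F, (if x ∈ U then φ x else 0) := by
      rw [← Finset.sum_filter]
      exact (Finset.sum_subtype _ (by simp) φ).symm
    rw [e1, ← Finset.add_sum_erase _ _ (Finset.mem_univ 0),
      ← Finset.add_sum_erase Finset.univ (fun x => if x ∈ U ∧ x ≠ 0 then φ x else 0)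
        (Finset.mem_univ 0)]
    simp only [U.zero_mem, if_true, hφ0, ne_eq, not_true_eq_false, and_false, if_false, zero_add]
    congr 1
    refine Finset.sum_congr rfl fun x hx => ?_
    simp [Finset.ne_of_mem_erase hx]
  have h3 : (((∑ v, prodWeight p v * (if ∀ x ∈ U, x ⬝ᵥ v = 0 then 1 else 0) - Q : ℝ)) : ℂ) =
      Q * ∑ x : Fin n → F, (if x ∈ U ∧ x ≠ 0 then φ x else 0) := by
    rw [Complex.ofReal_sub, h1, h2]; ring
  rw [← Real.norm_eq_abs, ← Complex.norm_real, h3, norm_mul, Complex.norm_real, Real.norm_of_nonneg hQ0]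
  refine mul_le_mul_of_nonneg_left ((norm_sum_le _ _).trans (Finset.sum_le_sum fun x _ => ?_)) hQ0
  split_ifs
  · simp [hφ]
  · simp

-- Once all coordinates except one with `x i ≠ 0` are fixed, a single value of the remaining
-- coordinate solves the equation.
open Classical in
theorem sum_prodWeight_dotProduct_eq_zero_le {p : Fin n → F → ℝ}
    (hp : ∀ j, NearUniformWeight C (p j)) {x : Fin n → F} (hx : x ≠ 0) :
    ∑ v, prodWeight p v * (if x ⬝ᵥ v = 0 then 1 else 0) ≤ C / Fintype.card F := by
  obtain ⟨i, hi⟩ := Function.ne_iff.1 hx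
  have hw : ∀ (a : F) (r : {j // j ≠ i} → F),
      prodWeight p ((Equiv.funSplitAt i F).symm (a, r)) =
        p i a * prodWeight (fun j : {j // j ≠ i} => p j) r := by
    intro a r
    simp only [prodWeight]
    rw [Fintype.prod_eq_mul_prod_subtype_ne _ i]
    congr 1
    · simp [Equiv.funSplitAt, Equiv.piSplitAt]
    · refine Finset.prod_congr rfl fun j _ => ?_
      simp [Equiv.funSplitAt, Equiv.piSplitAt, j.2]
  have hd : ∀ (a : F) (r : {j // j ≠ i} → F),
      x ⬝ᵥ ((Equiv.funSplitAt i F).symm (a, r)) = x i * a + ∑ j : {j // j ≠ i}, x j * r j := by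
    intro a r
    simp only [dotProduct]
    rw [Fintype.sum_eq_add_sum_subtype_ne _ i]
    congr 1
    · simp [Equiv.funSplitAt, Equiv.piSplitAt]
    · refine Finset.sum_congr rfl fun j _ => ?_
      simp [Equiv.funSplitAt, Equiv.piSplitAt, j.2]
  rw [← (Equiv.funSplitAt i F).symm.sum_comp, Fintype.sum_prod_type_right]
  simp_rw [hw, hd]
  calc _ ≤ ∑ r : {j // j ≠ i} → F, C / Fintype.card F *
        prodWeight (fun j : {j // j ≠ i} => p j) r := by
        refine Finset.sum_le_sum fun r _ => ?_
        rw [Finset.sum_eq_single (-(∑ j : {j // j ≠ i}, x j * r j) / x i)]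
        · rw [mul_div_cancel₀ _ hi]
          simp only [neg_add_cancel, if_true, mul_one]
          exact mul_le_mul_of_nonneg_right ((hp i).le _)
            (prodWeight_nonneg (fun j : {j // j ≠ i} => hp j) r)
        · intro b _ hb
          rw [if_neg, mul_zero]
          intro h
          exact hb (by rw [eq_div_iff hi, mul_comm]; exact eq_neg_of_add_eq_zero_left h)
        · simp
    _ = _ := by
        rw [← Finset.mul_sum, sum_prodWeight (fun j : {j // j ≠ i} => hp j), mul_one]

end Fourier

/-! ### The kernel dimension of a uniform matrix, and its distance to the limiting law. -/

section IdealChain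

/-- The law after `k` steps of the Markov chain started at `n` that moves from `d + 1` to `d` with
probability `1 - x ^ (d + 1)` and otherwise stays put: the law of the dimension of the kernel of a
uniform `k × n` matrix when `x = q⁻¹`. -/
noncomputable def uniformNullityLaw (x : ℝ) (n : ℕ) : ℕ → ℕ → ℝ
  | 0, d => if d = n then 1 else 0
  | k + 1, d => x ^ d * uniformNullityLaw x n k d +
      (1 - x ^ (d + 1)) * uniformNullityLaw x n k (d + 1)

variable {x : ℝ}

theorem uniformNullityLaw_nonneg (h0 : 0 < x) (h1 : x < 1) (n k d : ℕ) :
    0 ≤ uniformNullityLaw x n k d := by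
  induction k generalizing d with
  | zero => simp only [uniformNullityLaw]; split_ifs <;> norm_num
  | succ k ih =>
    have := (one_sub_pow_succ_pos h0 h1 d).le
    have := ih d
    have := ih (d + 1)
    simp only [uniformNullityLaw]
    positivity

theorem uniformNullityLaw_eq_zero_of_lt (x : ℝ) {n d : ℕ} (k : ℕ) (hd : n < d) :
    uniformNullityLaw x n k d = 0 := by
  induction k generalizing d with
  | zero => simp [uniformNullityLaw, hd.ne']
  | succ k ih => simp [uniformNullityLaw, ih hd, ih (Nat.lt_succ_of_lt hd)]

theorem uniformNullityLaw_eq_zero_of_add_lt (x : ℝ) {n k d : ℕ} (hd : k + d < n) :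
    uniformNullityLaw x n k d = 0 := by
  induction k generalizing d with
  | zero => simp [uniformNullityLaw]; omega
  | succ k ih => simp [uniformNullityLaw, ih (d := d) (by omega), ih (d := d + 1) (by omega)]

theorem sum_uniformNullityLaw (x : ℝ) (n k : ℕ) :
    ∑ d ∈ Finset.range (n + 1), uniformNullityLaw x n k d = 1 := by
  induction k with
  | zero => simp [uniformNullityLaw]
  | succ k ih =>
    have hz := uniformNullityLaw_eq_zero_of_lt x k (Nat.lt_succ_self n)
    simp only [uniformNullityLaw, Finset.sum_add_distrib]
    rw [Finset.sum_range_succ (fun d => (1 - x ^ (d + 1)) * uniformNullityLaw x n k (d + 1)), hz,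
      mul_zero, add_zero]
    have h : ∑ d ∈ Finset.range n, (1 - x ^ (d + 1)) * uniformNullityLaw x n k (d + 1) =
        ∑ d ∈ Finset.range (n + 1), (1 - x ^ d) * uniformNullityLaw x n k d := by
      rw [Finset.sum_range_succ']; simp
    rw [h, ← Finset.sum_add_distrib]
    exact (Finset.sum_congr rfl fun d _ => by ring).trans ih

/-- Here `r` is the rank and `j` the number of dependent rows among the `k` rows. The induction is a
`q`-Pascal recursion; for `r = 0` or `j = 0` only one of the two predecessor states carries mass, so
these cases are separate. -/
theorem uniformNullityLaw_eq (h0 : 0 < x) (h1 : x < 1) (k d r j : ℕ) (hk : r + j = k) :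
    uniformNullityLaw x (d + r) k d =
      x ^ (j * d) * qPoch x (d + r) * qPoch x k / (qPoch x d * qPoch x j * qPoch x r) := by
  have hp := fun m => (qPoch_pos h0 h1 m).ne'
  have h00 : qPoch x 0 = 1 := by simp [qPoch]
  induction k generalizing d r j with
  | zero =>
    obtain ⟨rfl, rfl⟩ : r = 0 ∧ j = 0 := by omega
    have := hp d
    simp [uniformNullityLaw, h00]
    field_simp
  | succ k ih =>
    simp only [uniformNullityLaw]
    rcases r with _ | r
    · obtain rfl : j = k + 1 := by omega
      rw [ih d 0 k (by omega), uniformNullityLaw_eq_zero_of_lt x k (by omega : d + 0 < d + 1)]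
      have := hp d
      have := hp k
      have := hp (k + 1)
      simp only [add_zero, h00]
      field_simp
      ring
    · have e2 : uniformNullityLaw x (d + (r + 1)) k (d + 1) =
          x ^ (j * (d + 1)) * qPoch x (d + (r + 1)) * qPoch x k /
            (qPoch x (d + 1) * qPoch x j * qPoch x r) := by
        have := ih (d + 1) r j (by omega)
        rwa [show d + 1 + r = d + (r + 1) by ring] at this
      have a1 := (one_sub_pow_succ_pos h0 h1 d).ne'
      have a2 := (one_sub_pow_succ_pos h0 h1 r).ne'
      have b1 := hp d
      have b2 := hp r
      have b3 := hp j
      rcases j with _ | j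
      · obtain rfl : r = k := by omega
        rw [e2, uniformNullityLaw_eq_zero_of_add_lt x (by omega : r + d < d + (r + 1))]
        rw [qPoch_succ x d, qPoch_succ x r]
        simp only [h00]
        field_simp
        ring
      · rw [e2, ih d (r + 1) j (by omega)]
        obtain rfl : k = r + 1 + j := by omega
        have a3 := (one_sub_pow_succ_pos h0 h1 j).ne'
        have b4 := hp j
        rw [qPoch_succ x d, qPoch_succ x r, qPoch_succ x j, qPoch_succ x (r + 1 + j)]
        have p1 : x ^ ((j + 1) * (d + 1)) = x ^ (j * d) * x ^ d * x ^ (j + 1) := by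
          rw [← pow_add, ← pow_add]; congr 1; ring
        have p2 : x ^ ((j + 1) * d) = x ^ (j * d) * x ^ d := by
          rw [← pow_add]; congr 1; ring
        have p3 : x ^ (r + 1 + j + 1) = x ^ (r + 1) * x ^ (j + 1) := by
          rw [← pow_add]; congr 1
        rw [p1, p2, p3]
        generalize x ^ (d + 1) = u at *
        generalize x ^ (r + 1) = v at *
        generalize x ^ (j + 1) = w at *
        field_simp
        ring

/-- The extra term `x ^ (m + 2)` makes the induction close: the next factor costs at most `(1 - x) *
x ^ (m + 2)`, which turns it into `x ^ (m + 3)`. -/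
theorem qPoch_ge (h0 : 0 < x) (h1 : x ≤ 1 / 2) (m : ℕ) :
    1 - x - x ^ 2 + x ^ (m + 2) ≤ qPoch x (m + 1) := by
  induction m with
  | zero => simp [qPoch]
  | succ m ih =>
    rw [qPoch_succ]
    have h := qPoch_pos h0 (by linarith) (m + 1)
    have h2 : qPoch x (m + 1) ≤ 1 - x := by
      have := antitone_qPoch h0 (by linarith) (Nat.le_add_left 1 m)
      simpa [qPoch] using this
    have h3 : 0 < x ^ (m + 2) := by positivity
    have e : x ^ (m + 1 + 2) = x ^ (m + 2) * x := by ring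
    rw [e, show m + 1 + 1 = m + 2 by ring]
    nlinarith

theorem qPochTail_zero_ge (h0 : 0 < x) (h1 : x ≤ 1 / 2) : 1 / 4 ≤ qPochTail x 0 := by
  have h := (tendsto_qPoch h0 (by linarith : x < 1)).comp (tendsto_add_atTop_nat 1)
  refine ge_of_tendsto' h fun m => ?_
  have := qPoch_ge h0 h1 m
  have h3 : 0 < x ^ (m + 2) := by positivity
  simp only [Function.comp]
  nlinarith

/-- The last summand is a reserve for the induction: a further factor costs `x ^ (m + d + 1)`, and
`x ≤ 1 / 2` lets half of the reserve pay for it. -/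
theorem le_qPoch_add (h0 : 0 < x) (h1 : x ≤ 1 / 2) (m d : ℕ) :
    qPoch x m * (1 - 2 * x ^ (m + 1) + 2 * x ^ (m + d + 1)) ≤ qPoch x (m + d) := by
  have hm := qPoch_pos h0 (by linarith) m
  induction d with
  | zero => simp
  | succ d ih =>
    rw [← add_assoc, qPoch_succ]
    have h := qPoch_pos h0 (by linarith) (m + d)
    have h2 := antitone_qPoch h0 (by linarith) (Nat.le_add_right m d)
    have h3 : 0 < x ^ (m + d + 1) := by positivity
    have e : x ^ (m + d + 1 + 1) = x ^ (m + d + 1) * x := by ring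
    rw [e]
    generalize x ^ (m + d + 1) = y at *
    have : qPoch x (m + d) * y ≤ qPoch x m * y := by gcongr
    have : qPoch x m * y * x ≤ qPoch x m * y * (1 / 2) := by gcongr
    nlinarith

theorem limitCorankProb_eq {q : ℕ} (hq : 1 < q) (d : ℕ) :
    limitCorankProb q d =
      ((q : ℝ)⁻¹) ^ (d * d) * qPochTail ((q : ℝ)⁻¹) 0 / qPoch ((q : ℝ)⁻¹) d ^ 2 := by
  have hq' : (1 : ℝ) < q := by exact_mod_cast hq
  have h0 : 0 < (q : ℝ)⁻¹ := by positivity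
  have h1 : (q : ℝ)⁻¹ < 1 := inv_lt_one_of_one_lt₀ hq'
  have hP := (qPoch_pos h0 h1 d).ne'
  rw [← qPoch_mul_qPochTail h0 h1 d, limitCorankProb, ← sq, inv_pow]
  field_simp

/-- A one-sided bound suffices, because both laws have total mass one (`tsum_abs_sub_le_of_sub_le`).
The closed forms differ by a relative error of order `x ^ (n - d + 1)`, and the factor `x ^ (d * d)`
supplies the missing decay in `d`. -/
theorem limitCorankProb_sub_uniformNullityLaw_le {q : ℕ} (hq : 1 < q) (n d : ℕ) :
    limitCorankProb q d - uniformNullityLaw ((q : ℝ)⁻¹) n n d ≤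
      32 * ((q : ℝ)⁻¹) ^ n * ((q : ℝ)⁻¹) ^ d := by
  have hq2 : (2 : ℝ) ≤ q := by exact_mod_cast hq
  rw [limitCorankProb_eq hq]
  set x : ℝ := (q : ℝ)⁻¹ with hx
  have h0 : 0 < x := by positivity
  have h12 : x ≤ 1 / 2 := by rw [hx, one_div]; exact inv_anti₀ two_pos hq2
  have h1 : x < 1 := by linarith
  have hT : 1 / 4 ≤ qPochTail x 0 := qPochTail_zero_ge h0 h12
  have hTd : qPochTail x 0 ≤ qPoch x d := qPochTail_zero_le h0 h1 d
  have hT1 : ∀ m, qPoch x m ≤ 1 := fun m => by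
    simpa [qPoch] using antitone_qPoch h0 h1 (Nat.zero_le m)
  have hPd : 0 < qPoch x d := qPoch_pos h0 h1 d
  -- The constant 16 is the inverse square of the lower bound `1 / 4` for `qPoch x d`.
  have hinv : 1 / qPoch x d ^ 2 ≤ 16 := by
    rw [div_le_iff₀ (by positivity)]
    nlinarith
  rcases le_or_gt d n with hdn | hdn
  · obtain ⟨r, rfl⟩ := Nat.exists_eq_add_of_le hdn
    have hr := qPoch_pos h0 h1 r
    rw [uniformNullityLaw_eq h0 h1 (d + r) d r d (add_comm r d)]
    have key := le_qPoch_add h0 h12 r d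
    have hle : qPochTail x 0 ≤ qPoch x (d + r) := qPochTail_zero_le h0 h1 _
    have hpos := qPoch_pos h0 h1 (d + r)
    have hdr1 := hT1 (d + r)
    rw [add_comm r d] at key
    have key2 : 1 - 2 * x ^ (r + 1) ≤ qPoch x (d + r) / qPoch x r := by
      rw [le_div_iff₀ hr]
      have : 0 < qPoch x r * x ^ (d + r + 1) := by positivity
      nlinarith
    have key3 : qPochTail x 0 - qPoch x (d + r) * (qPoch x (d + r) / qPoch x r) ≤
        2 * x ^ (r + 1) := by
      have : 0 < x ^ (r + 1) := by positivity
      have : qPoch x (d + r) * (1 - 2 * x ^ (r + 1)) ≤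
        qPoch x (d + r) * (qPoch x (d + r) / qPoch x r) := by gcongr
      nlinarith
    -- This is `(d - 1)² ≥ 0`, that is `2 d ≤ d² + 1`.
    have hexp : x ^ (d * d) * x ^ (r + 1) ≤ x ^ (d + r) * x ^ d := by
      rw [← pow_add, ← pow_add]
      refine pow_le_pow_of_le_one h0.le h1.le ?_
      have : d + d ≤ d * d + 1 := by
        zify; nlinarith [sq_nonneg ((d : ℤ) - 1)]
      omega
    calc _ = x ^ (d * d) * (1 / qPoch x d ^ 2) *
          (qPochTail x 0 - qPoch x (d + r) * (qPoch x (d + r) / qPoch x r)) := by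
          field_simp
      _ ≤ x ^ (d * d) * (1 / qPoch x d ^ 2) * (2 * x ^ (r + 1)) := by gcongr
      _ = (1 / qPoch x d ^ 2) * (2 * (x ^ (d * d) * x ^ (r + 1))) := by ring
      _ ≤ 16 * (2 * (x ^ (d + r) * x ^ d)) := by gcongr
      _ = _ := by ring
  · rw [uniformNullityLaw_eq_zero_of_lt x n hdn, sub_zero]
    have hexp : x ^ (d * d) ≤ x ^ n * x ^ d := by
      rw [← pow_add]
      refine pow_le_pow_of_le_one h0.le h1.le ?_
      nlinarith
    have hT2 : qPochTail x 0 ≤ 1 := hTd.trans (hT1 d)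
    calc _ = x ^ (d * d) * qPochTail x 0 * (1 / qPoch x d ^ 2) := by ring
      _ ≤ (x ^ n * x ^ d) * 1 * 16 := by gcongr
      _ ≤ _ := by
        have : 0 < x ^ n * x ^ d := by positivity
        nlinarith

/-- Pointwise `|a - b| = (a - b) + 2 (b - a)⁺`, and the terms `a - b` sum to zero. -/
theorem tsum_abs_sub_le_of_sub_le {a b e : ℕ → ℝ} {s : ℝ} (ha : HasSum a 1) (hb : HasSum b 1)
    (he : HasSum e s) (he0 : ∀ d, 0 ≤ e d) (h : ∀ d, b d - a d ≤ e d) :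
    ∑' d, |a d - b d| ≤ 2 * s := by
  have hs : HasSum (fun d => (a d - b d) + 2 * e d) (2 * s) := by
    simpa using (ha.sub hb).add (he.mul_left 2)
  rw [← hs.tsum_eq]
  refine Summable.tsum_le_tsum (fun d => ?_) (ha.summable.sub hb.summable).abs hs.summable
  have := h d
  have := he0 d
  rcases abs_cases (a d - b d) with h' | h' <;> linarith

theorem hasSum_uniformNullityLaw (x : ℝ) (n k : ℕ) : HasSum (uniformNullityLaw x n k) 1 := by
  rw [← sum_uniformNullityLaw x n k]
  refine hasSum_sum_of_ne_finset_zero fun d hd => uniformNullityLaw_eq_zero_of_lt x k ?_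
  simpa using hd

theorem tsum_abs_uniformNullityLaw_sub_limitCorankProb_le {q : ℕ} (hq : 1 < q) (n : ℕ) :
    ∑' d, |uniformNullityLaw ((q : ℝ)⁻¹) n n d - limitCorankProb q d| ≤
      128 * ((q : ℝ)⁻¹) ^ n := by
  have hq2 : (2 : ℝ) ≤ q := by exact_mod_cast hq
  have h0 : 0 < (q : ℝ)⁻¹ := by positivity
  have h12 : (q : ℝ)⁻¹ ≤ 1 / 2 := by rw [one_div]; exact inv_anti₀ two_pos hq2
  have hg := (hasSum_geometric_of_lt_one h0.le (by linarith)).mul_left (32 * ((q : ℝ)⁻¹) ^ n)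
  refine (tsum_abs_sub_le_of_sub_le (hasSum_uniformNullityLaw _ n n) (hasSum_limitCorankProb hq) hg
    (fun d => by positivity) (limitCorankProb_sub_uniformNullityLaw_le hq n)).trans ?_
  -- The constant is `128 = 2 * 32 * 2`, the last factor bounding the geometric series.
  have h3 : (1 - (q : ℝ)⁻¹)⁻¹ ≤ 2 := by
    rw [inv_le_comm₀ (by linarith) two_pos]; linarith
  have : 0 < ((q : ℝ)⁻¹) ^ n := by positivity
  nlinarith

end IdealChain

/-! ### Exposing random rows, and comparison with the uniform chain. -/

section RowChain

variable {F : Type*} [Field F] {n : ℕ}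

/-- The linear form `y ↦ y ⬝ᵥ v`. -/
noncomputable def dotForm (v : Fin n → F) : (Fin n → F) →ₗ[F] F := Fintype.linearCombination F v

theorem dotForm_apply (v y : Fin n → F) : dotForm v y = y ⬝ᵥ v := by
  simp [dotForm, Fintype.linearCombination_apply, dotProduct]

theorem finrank_inf_ker_dotForm_of_forall {U : Submodule F (Fin n → F)} {v : Fin n → F}
    (h : ∀ y ∈ U, y ⬝ᵥ v = 0) :
    Module.finrank F ↥(U ⊓ LinearMap.ker (dotForm v)) = Module.finrank F U := by
  rw [inf_eq_left.2 fun y hy => by rw [LinearMap.mem_ker, dotForm_apply]; exact h y hy]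

theorem finrank_inf_ker_dotForm_add_one {U : Submodule F (Fin n → F)} {v : Fin n → F}
    (h : ¬ ∀ y ∈ U, y ⬝ᵥ v = 0) :
    Module.finrank F ↥(U ⊓ LinearMap.ker (dotForm v)) + 1 = Module.finrank F U := by
  have hne : (dotForm v).domRestrict U ≠ 0 := by
    intro h0
    refine h fun y hy => ?_
    have := LinearMap.congr_fun h0 ⟨y, hy⟩
    simpa [dotForm_apply] using this
  rw [← Module.Dual.finrank_ker_add_one_of_ne_zero hne, LinearMap.ker_domRestrict,
    ← Submodule.map_comap_subtype, Submodule.finrank_map_subtype_eq]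

/-- The common kernel of the linear forms attached to the rows `Y i`. -/
noncomputable def rowKer {k : ℕ} (Y : Fin k → Fin n → F) : Submodule F (Fin n → F) :=
  LinearMap.ker (Matrix.mulVecLin (Matrix.of Y))

theorem mem_rowKer {k : ℕ} {Y : Fin k → Fin n → F} {y : Fin n → F} :
    y ∈ rowKer Y ↔ ∀ i, y ⬝ᵥ Y i = 0 := by
  rw [rowKer, LinearMap.mem_ker, Matrix.mulVecLin_apply, funext_iff]
  simp only [Matrix.mulVec, Pi.zero_apply]
  exact forall_congr' fun i => by rw [dotProduct_comm]; rfl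

theorem rowKer_snoc {k : ℕ} (Y : Fin k → Fin n → F) (v : Fin n → F) :
    rowKer (Fin.snoc (α := fun _ => Fin n → F) Y v) = rowKer Y ⊓ LinearMap.ker (dotForm v) := by
  ext y
  rw [Submodule.mem_inf, mem_rowKer, mem_rowKer, LinearMap.mem_ker, dotForm_apply,
    Fin.forall_fin_succ']
  simp

theorem rank_add_finrank_rowKer {k : ℕ} (Y : Matrix (Fin k) (Fin n) F) :
    Y.rank + Module.finrank F (rowKer Y) = n := by
  have := LinearMap.finrank_range_add_finrank_ker (Matrix.mulVecLin Y)
  rw [Module.finrank_fin_fun] at this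
  exact this

variable [Fintype F]

/-- The expectation of `f` at the common kernel of `k` independent random rows, the `i`-th one
having law `prodWeight (p i)`. -/
noncomputable def rowExp (p : ℕ → Fin n → F → ℝ) (k : ℕ) (f : Submodule F (Fin n → F) → ℝ) : ℝ :=
  ∑ Y : Fin k → Fin n → F, (∏ i : Fin k, prodWeight (p i) (Y i)) * f (rowKer Y)

variable {p : ℕ → Fin n → F → ℝ} {C : ℝ} {k : ℕ} {f g : Submodule F (Fin n → F) → ℝ}

theorem rowExp_add (p : ℕ → Fin n → F → ℝ) (k : ℕ) (f g : Submodule F (Fin n → F) → ℝ) :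
    rowExp p k (fun U => f U + g U) = rowExp p k f + rowExp p k g := by
  simp [rowExp, mul_add, Finset.sum_add_distrib]

theorem rowExp_const_mul (p : ℕ → Fin n → F → ℝ) (k : ℕ) (c : ℝ)
    (f : Submodule F (Fin n → F) → ℝ) :
    rowExp p k (fun U => c * f U) = c * rowExp p k f := by
  simp [rowExp, Finset.mul_sum, mul_left_comm]

theorem rowExp_sum {ι : Type*} (s : Finset ι) (p : ℕ → Fin n → F → ℝ) (k : ℕ)
    (f : ι → Submodule F (Fin n → F) → ℝ) :
    rowExp p k (fun U => ∑ i ∈ s, f i U) = ∑ i ∈ s, rowExp p k (f i) := by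
  simp only [rowExp, Finset.mul_sum]
  rw [Finset.sum_comm]

/-- The comparison is needed only at kernels of `k` rows, which makes the bound `dim U ≥ n - k`
available in applications. -/
theorem rowExp_mono (hp : ∀ i j, NearUniformWeight C (p i j))
    (h : ∀ Y : Fin k → Fin n → F, f (rowKer Y) ≤ g (rowKer Y)) : rowExp p k f ≤ rowExp p k g :=
  Finset.sum_le_sum fun Y _ => mul_le_mul_of_nonneg_left (h Y)
    (Finset.prod_nonneg fun i _ => prodWeight_nonneg (hp i) _)

theorem abs_rowExp_le (hp : ∀ i j, NearUniformWeight C (p i j)) :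
    |rowExp p k f| ≤ rowExp p k fun U => |f U| := by
  refine (Finset.abs_sum_le_sum_abs _ _).trans (Finset.sum_le_sum fun Y _ => ?_)
  rw [abs_mul, abs_of_nonneg
    (Finset.prod_nonneg fun (i : Fin k) _ => prodWeight_nonneg (hp i) (Y i))]

theorem rowExp_zero (p : ℕ → Fin n → F → ℝ) (f : Submodule F (Fin n → F) → ℝ) :
    rowExp p 0 f = f ⊤ := by
  have : ∀ Y : Fin 0 → Fin n → F, rowKer Y = ⊤ := fun Y =>
    eq_top_iff.2 fun y _ => mem_rowKer.2 fun i => i.elim0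
  simp [rowExp, this]

/-- Conditioning on the first `k` rows: the last row is independent of them and cuts their kernel by
one hyperplane or by nothing. -/
theorem rowExp_succ (p : ℕ → Fin n → F → ℝ) (k : ℕ) (f : Submodule F (Fin n → F) → ℝ) :
    rowExp p (k + 1) f =
      rowExp p k fun U => ∑ v, prodWeight (p k) v * f (U ⊓ LinearMap.ker (dotForm v)) := by
  rw [rowExp, ← (Fin.snocEquiv fun _ : Fin (k + 1) => Fin n → F).sum_comp,
    Fintype.sum_prod_type_right]
  refine Finset.sum_congr rfl fun Y _ => ?_
  rw [Finset.mul_sum]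
  refine Finset.sum_congr rfl fun v _ => ?_
  have e : (Fin.snocEquiv fun _ : Fin (k + 1) => Fin n → F) (v, Y) =
    Fin.snoc (α := fun _ => Fin n → F) Y v := rfl
  rw [e, rowKer_snoc, Fin.prod_univ_castSucc]
  simp [mul_assoc]

open Classical in
theorem rowExp_mem_le (hp : ∀ i j, NearUniformWeight C (p i j)) (k : ℕ) {y : Fin n → F}
    (hy : y ≠ 0) :
    rowExp p k (fun U => if y ∈ U then 1 else 0) ≤ (C / Fintype.card F) ^ k := by
  induction k with
  | zero => simp [rowExp_zero]
  | succ k ih =>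
    rw [rowExp_succ]
    have hC : 0 ≤ C / Fintype.card F := by
      obtain ⟨i, -⟩ := Function.ne_iff.1 hy
      exact ((hp 0 i).nonneg 0).trans ((hp 0 i).le 0)
    calc _ ≤ rowExp p k fun U => C / Fintype.card F * (if y ∈ U then 1 else 0) := by
          refine rowExp_mono hp fun Y => ?_
          simp only [Submodule.mem_inf, LinearMap.mem_ker, dotForm_apply]
          by_cases h : y ∈ rowKer Y
          · simpa [h] using sum_prodWeight_dotProduct_eq_zero_le (hp k) hy
          · simp [h]
      _ = C / Fintype.card F * rowExp p k fun U => if y ∈ U then 1 else 0 :=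
          rowExp_const_mul _ _ _ _
      _ ≤ _ := by
          rw [pow_succ']
          exact mul_le_mul_of_nonneg_left ih hC

open Classical in
/-- The probability that a row with law `prodWeight w` vanishes on `U`. -/
noncomputable def annihilateProb (w : Fin n → F → ℝ) (U : Submodule F (Fin n → F)) : ℝ :=
  ∑ v, prodWeight w v * (if ∀ y ∈ U, y ⬝ᵥ v = 0 then 1 else 0)

-- The Fourier error is a sum over nonzero `y ∈ U`. Exchanging this sum with the expectation over
-- `U` replaces membership by its probability, at most `(C / q) ^ k` uniformly in `y`, and leaves
-- the full `ℓ¹` norm of the Fourier transform.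
open Classical in
theorem rowExp_abs_annihilateProb_sub_le (hC : 0 ≤ C) (hp : ∀ i j, NearUniformWeight C (p i j))
    (hk : k ≤ n) :
    rowExp p k (fun U => |annihilateProb (p k) U -
        ((Fintype.card F : ℝ)⁻¹) ^ Module.finrank F U|) ≤
      ((Fintype.card F : ℝ)⁻¹) ^ (n - k) *
        (√(C * Fintype.card F) ^ n * (C / Fintype.card F) ^ k) := by
  obtain ⟨ψ, hψ⟩ := exists_isPrimitive_addChar F
  have hq : (1 : ℝ) ≤ Fintype.card F := by exact_mod_cast Fintype.card_pos (α := F)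
  set x : ℝ := (Fintype.card F : ℝ)⁻¹ with hx
  have hx0 : 0 ≤ x := by positivity
  have hx1 : x ≤ 1 := inv_le_one_of_one_le₀ hq
  set A : (Fin n → F) → ℝ := fun y => ∏ j, ‖weightFourier ψ (p k j) (y j)‖ with hA
  have hA0 : ∀ y, 0 ≤ A y := fun y => Finset.prod_nonneg fun _ _ => norm_nonneg _
  calc _ ≤ rowExp p k fun U => x ^ (n - k) *
        ∑ y : Fin n → F, (if y ≠ 0 then A y else 0) * (if y ∈ U then 1 else 0) := by
        refine rowExp_mono hp fun Y => ?_
        refine (abs_sum_prodWeight_annihilates_sub_le hψ (hp k) (rowKer Y)).trans ?_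
        have hr : n - k ≤ Module.finrank F (rowKer Y) := by
          have h1 := rank_add_finrank_rowKer (Matrix.of Y)
          have h2 := (Matrix.of Y).rank_le_height
          have e : rowKer (Matrix.of Y) = rowKer Y := rfl
          rw [e] at h1
          omega
        refine mul_le_mul (pow_le_pow_of_le_one hx0 hx1 hr) (le_of_eq ?_)
          (Finset.sum_nonneg fun y _ => ?_) (by positivity)
        · refine Finset.sum_congr rfl fun y _ => ?_
          by_cases h1 : y ∈ rowKer Y <;> by_cases h2 : y = 0 <;> simp [h1, h2, hA]
        · split_ifs
          · exact hA0 y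
          · exact le_rfl
    _ = x ^ (n - k) * ∑ y : Fin n → F, (if y ≠ 0 then A y else 0) *
          rowExp p k (fun U => if y ∈ U then 1 else 0) := by
        rw [rowExp_const_mul, rowExp_sum]
        simp_rw [rowExp_const_mul]
    _ ≤ x ^ (n - k) * ∑ y : Fin n → F, A y * (C / Fintype.card F) ^ k := by
        refine mul_le_mul_of_nonneg_left (Finset.sum_le_sum fun y _ => ?_) (by positivity)
        by_cases h : y = 0
        · rw [if_neg (not_not.2 h), zero_mul]
          exact mul_nonneg (hA0 y) (by positivity)
        · rw [if_pos h]
          exact mul_le_mul_of_nonneg_left (rowExp_mem_le hp k h) (hA0 y)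
    _ ≤ _ := by
        rw [← Finset.sum_mul]
        have := sum_prod_norm_weightFourier_le hψ (hp k)
        gcongr

/-- The law of the dimension of the common kernel of the first `k` random rows. -/
noncomputable def nullityLaw (p : ℕ → Fin n → F → ℝ) (k d : ℕ) : ℝ :=
  rowExp p k fun U => if Module.finrank F U = d then 1 else 0

theorem sum_prodWeight_finrank_inf_eq {w : Fin n → F → ℝ} (hw : ∀ j, NearUniformWeight C (w j))
    (U : Submodule F (Fin n → F)) (d : ℕ) :
    ∑ v, prodWeight w v *
        (if Module.finrank F ↥(U ⊓ LinearMap.ker (dotForm v)) = d then (1 : ℝ) else 0) =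
      annihilateProb w U * (if Module.finrank F U = d then 1 else 0) +
        (1 - annihilateProb w U) * (if Module.finrank F U = d + 1 then 1 else 0) := by
  classical
  have h1 : 1 - annihilateProb w U =
      ∑ v, prodWeight w v * (1 - if ∀ y ∈ U, y ⬝ᵥ v = 0 then 1 else 0) := by
    simp only [mul_sub, Finset.sum_sub_distrib, mul_one, sum_prodWeight hw, annihilateProb]
  rw [h1, annihilateProb, Finset.sum_mul, Finset.sum_mul, ← Finset.sum_add_distrib]
  refine Finset.sum_congr rfl fun v _ => ?_
  by_cases h : ∀ y ∈ U, y ⬝ᵥ v = 0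
  · rw [finrank_inf_ker_dotForm_of_forall h]
    simp only [if_pos h]
    ring
  · rw [← finrank_inf_ker_dotForm_add_one h]
    simp [h]

/-- The old difference of laws is transported by the transition kernel of the uniform chain, which
does not increase the `ℓ¹` norm. The new error at `U` misplaces mass between `dim U` and `dim U -
1`, so it is counted at most twice. -/
theorem sum_abs_nullityLaw_sub_succ_le (hp : ∀ i j, NearUniformWeight C (p i j)) (k : ℕ) :
    ∑ d ∈ Finset.range (n + 1),
        |nullityLaw p (k + 1) d - uniformNullityLaw (Fintype.card F : ℝ)⁻¹ n (k + 1) d| ≤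
      ∑ d ∈ Finset.range (n + 1),
        |nullityLaw p k d - uniformNullityLaw (Fintype.card F : ℝ)⁻¹ n k d| +
      2 * rowExp p k (fun U => |annihilateProb (p k) U -
        ((Fintype.card F : ℝ)⁻¹) ^ Module.finrank F U|) := by
  set x : ℝ := (Fintype.card F : ℝ)⁻¹ with hx
  have hq : (1 : ℝ) ≤ Fintype.card F := by exact_mod_cast Fintype.card_pos (α := F)
  have hx0 : 0 ≤ x := by positivity
  have hx1 : x ≤ 1 := inv_le_one_of_one_le₀ hq
  set e : Submodule F (Fin n → F) → ℝ :=
    fun U => annihilateProb (p k) U - x ^ Module.finrank F U with he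
  set I : ℕ → Submodule F (Fin n → F) → ℝ :=
    fun d U => if Module.finrank F U = d then 1 else 0 with hI
  have hI0 : ∀ d U, 0 ≤ I d U := fun d U => by simp only [hI]; split_ifs <;> norm_num
  set Δ : ℕ → ℝ := fun d => nullityLaw p k d - uniformNullityLaw x n k d with hΔ
  -- The dimension alone need not be Markov here, since the annihilation probability depends on `U`.
  -- Writing it as `x ^ dim U + e U` isolates a Markov step plus an averaged error.
  have hstep : ∀ d, nullityLaw p (k + 1) d =
      x ^ d * nullityLaw p k d + (1 - x ^ (d + 1)) * nullityLaw p k (d + 1) +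
        rowExp p k (fun U => (I d U - I (d + 1) U) * e U) := by
    intro d
    simp only [nullityLaw]
    rw [rowExp_succ, ← rowExp_const_mul, ← rowExp_const_mul, ← rowExp_add, ← rowExp_add]
    congr 1
    funext U
    rw [sum_prodWeight_finrank_inf_eq (hp k)]
    simp only [hI, he]
    by_cases h1 : Module.finrank F U = d
    · simp [h1]
    · by_cases h2 : Module.finrank F U = d + 1
      · simp [h2]
      · simp [h1, h2]
  have hsumI : ∀ U, ∑ d ∈ Finset.range (n + 1), (I d U + I (d + 1) U) ≤ 2 := by
    intro U
    have h1 : ∀ N, ∑ d ∈ Finset.range N, I d U ≤ 1 := fun N => by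
      simp only [hI, Finset.sum_ite_eq]
      split_ifs <;> norm_num
    have h2 := h1 (n + 1 + 1)
    rw [Finset.sum_range_succ'] at h2
    rw [Finset.sum_add_distrib]
    linarith [h1 (n + 1), hI0 0 U]
  have hΔn : Δ (n + 1) = 0 := by
    have : nullityLaw p k (n + 1) = 0 := by
      refine Finset.sum_eq_zero fun Y _ => ?_
      have : Module.finrank F (rowKer Y) ≤ n := by
        simpa using Submodule.finrank_le (rowKer Y)
      simp only [if_neg (show Module.finrank F (rowKer Y) ≠ n + 1 by omega), mul_zero]
    simp [hΔ, this, uniformNullityLaw_eq_zero_of_lt x k (Nat.lt_succ_self n)]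
  have hbound : ∀ d, |nullityLaw p (k + 1) d - uniformNullityLaw x n (k + 1) d| ≤
      x ^ d * |Δ d| + (1 - x ^ (d + 1)) * |Δ (d + 1)| +
        rowExp p k (fun U => (I d U + I (d + 1) U) * |e U|) := by
    intro d
    have e1 : nullityLaw p (k + 1) d - uniformNullityLaw x n (k + 1) d =
        x ^ d * Δ d + (1 - x ^ (d + 1)) * Δ (d + 1) +
          rowExp p k (fun U => (I d U - I (d + 1) U) * e U) := by
      rw [hstep, uniformNullityLaw]; simp only [hΔ]; ring
    have hx2 : 0 ≤ 1 - x ^ (d + 1) := sub_nonneg.2 (pow_le_one₀ hx0 hx1)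
    rw [e1]
    refine (abs_add_le _ _).trans (add_le_add ((abs_add_le _ _).trans (le_of_eq ?_)) ?_)
    · rw [abs_mul, abs_mul, abs_of_nonneg (pow_nonneg hx0 d), abs_of_nonneg hx2]
    · refine (abs_rowExp_le hp).trans (rowExp_mono hp fun Y => ?_)
      rw [abs_mul]
      refine mul_le_mul_of_nonneg_right ((abs_sub _ _).trans (le_of_eq ?_)) (abs_nonneg _)
      rw [abs_of_nonneg (hI0 _ _), abs_of_nonneg (hI0 _ _)]
  refine (Finset.sum_le_sum fun d _ => hbound d).trans ?_
  rw [Finset.sum_add_distrib]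
  refine add_le_add (le_of_eq ?_) ?_
  · rw [Finset.sum_add_distrib, Finset.sum_range_succ (fun d => (1 - x ^ (d + 1)) * |Δ (d + 1)|),
      hΔn, abs_zero, mul_zero, add_zero]
    -- After the shift of index, the coefficients `x ^ d` and `1 - x ^ d` of `|Δ d|` add up to one;
    -- the term `d = 0` added by the shift vanishes.
    have h : ∑ d ∈ Finset.range n, (1 - x ^ (d + 1)) * |Δ (d + 1)| =
        ∑ d ∈ Finset.range (n + 1), (1 - x ^ d) * |Δ d| := by
      rw [Finset.sum_range_succ']; simp
    rw [h, ← Finset.sum_add_distrib]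
    exact Finset.sum_congr rfl fun d _ => by ring
  · rw [← rowExp_sum, ← rowExp_const_mul]
    refine rowExp_mono hp fun Y => ?_
    rw [← Finset.sum_mul]
    exact mul_le_mul_of_nonneg_right (hsumI _) (abs_nonneg _)

theorem sum_abs_nullityLaw_sub_le (hC : 1 ≤ C) (hp : ∀ i j, NearUniformWeight C (p i j))
    (hk : k ≤ n) :
    ∑ d ∈ Finset.range (n + 1),
        |nullityLaw p k d - uniformNullityLaw (Fintype.card F : ℝ)⁻¹ n k d| ≤
      k * (2 * √(C ^ 3 / Fintype.card F) ^ n) := by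
  have hq : (0 : ℝ) < Fintype.card F := by exact_mod_cast Fintype.card_pos (α := F)
  induction k with
  | zero => simp [nullityLaw, rowExp_zero, uniformNullityLaw, eq_comm]
  | succ k ih =>
    refine (sum_abs_nullityLaw_sub_succ_le hp k).trans ?_
    have h1 := rowExp_abs_annihilateProb_sub_le (k := k) (by linarith) hp (by omega)
    have h2 : ((Fintype.card F : ℝ)⁻¹) ^ (n - k) *
        (√(C * Fintype.card F) ^ n * (C / Fintype.card F) ^ k) ≤
        √(C ^ 3 / Fintype.card F) ^ n := by
      -- The powers of `q⁻¹` from the dimension and from membership combine to exactly `n`, for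
      -- every `k`. Against the Fourier norm `√(C q) ^ n` half of this decay survives, which is the
      -- source of the exponent `n / 2`.
      have e : √(C ^ 3 / Fintype.card F) = C * (Fintype.card F : ℝ)⁻¹ * √(C * Fintype.card F) := by
        rw [Real.sqrt_eq_iff_mul_self_eq (by positivity) (by positivity)]
        rw [mul_mul_mul_comm, Real.mul_self_sqrt (by positivity)]
        field_simp
      have hCk : C ^ k ≤ C ^ n := pow_le_pow_right₀ hC (by omega)
      rw [e, mul_pow, mul_pow, div_eq_mul_inv, mul_pow]
      calc _ = C ^ k * (((Fintype.card F : ℝ)⁻¹) ^ (n - k) * ((Fintype.card F : ℝ)⁻¹) ^ k) *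
            √(C * Fintype.card F) ^ n := by ring
        _ = C ^ k * ((Fintype.card F : ℝ)⁻¹) ^ n * √(C * Fintype.card F) ^ n := by
            rw [← pow_add, Nat.sub_add_cancel (by omega)]
        _ ≤ _ := by gcongr
    have := ih (by omega)
    push_cast
    linarith

end RowChain

/-! ### From random matrices to weights on rows. -/

section RandomMatrix

theorem nearUniformWeight_measureReal {F Ω : Type*} [Fintype F] [MeasurableSpace F]
    [MeasurableSingletonClass F] [MeasurableSpace Ω] {μ : Measure Ω} [IsProbabilityMeasure μ]
    {C : ℝ} {ξ : Ω → F} (hm : Measurable ξ) (h : IsNearUniform μ C ξ) :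
    NearUniformWeight C fun a => μ.real {ω | ξ ω = a} where
  nonneg _ := measureReal_nonneg
  sum_eq_one := by
    have := sum_measureReal_preimage_singleton (μ := μ) (f := ξ) Finset.univ
      fun a _ => hm (measurableSet_singleton a)
    rw [Finset.coe_univ, Set.preimage_univ, probReal_univ] at this
    exact this
  le := h

theorem nearUniformWeight_uniform (F : Type*) [Fintype F] [Nonempty F] {C : ℝ} (hC : 1 ≤ C) :
    NearUniformWeight C fun _ : F => 1 / (Fintype.card F : ℝ) where
  nonneg _ := by positivity
  sum_eq_one := by simp
  le _ := by gcongr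

variable {F : Type*} [MeasurableSpace F] [MeasurableSingletonClass F]
  {n : ℕ} {Ω : Type*} [MeasurableSpace Ω] {μ : Measure Ω}
  {M : Ω → Matrix (Fin n) (Fin n) F}

theorem measurableSet_matrix_eq (hm : ∀ i j, Measurable fun ω => M ω i j)
    (A : Matrix (Fin n) (Fin n) F) : MeasurableSet (M ⁻¹' {A}) := by
  have e : M ⁻¹' {A} = ⋂ i, ⋂ j, (fun ω => M ω i j) ⁻¹' {A i j} := by
    ext ω
    simp [← Matrix.ext_iff]
  rw [e]
  exact MeasurableSet.iInter fun i => MeasurableSet.iInter fun j =>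
    hm i j (measurableSet_singleton _)

variable [Fintype F]

/-- The laws of the entries of `M`, padded by uniform rows. -/
noncomputable def entryWeight (μ : Measure Ω) (M : Ω → Matrix (Fin n) (Fin n) F) (i : ℕ)
    (j : Fin n) (a : F) : ℝ :=
  if h : i < n then μ.real {ω | M ω ⟨i, h⟩ j = a} else 1 / (Fintype.card F : ℝ)

theorem measureReal_matrix_eq
    (hind : iIndepFun (fun (p : Fin n × Fin n) ω => M ω p.1 p.2) μ)
    (A : Matrix (Fin n) (Fin n) F) :
    μ.real (M ⁻¹' {A}) = ∏ i : Fin n, prodWeight (entryWeight μ M i) (A i) := by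
  have e : M ⁻¹' {A} = ⋂ p ∈ (Finset.univ : Finset (Fin n × Fin n)),
      (fun ω => M ω p.1 p.2) ⁻¹' {A p.1 p.2} := by
    ext ω
    simp [← Matrix.ext_iff]
  rw [measureReal_def, e, hind.measure_inter_preimage_eq_mul Finset.univ
    fun p _ => measurableSet_singleton _, ENNReal.toReal_prod, Fintype.prod_prod_type]
  refine Finset.prod_congr rfl fun i _ => Finset.prod_congr rfl fun j _ => ?_
  simp only [entryWeight, i.2, dif_pos]
  rfl

variable [Field F] [IsProbabilityMeasure μ]

theorem nearUniformWeight_entryWeight {C : ℝ} (hC : 1 ≤ C)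
    (hm : ∀ i j, Measurable fun ω => M ω i j)
    (h : ∀ i j, IsNearUniform μ C fun ω => M ω i j) (i : ℕ) (j : Fin n) :
    NearUniformWeight C (entryWeight μ M i j) := by
  by_cases hi : i < n
  · convert nearUniformWeight_measureReal (hm ⟨i, hi⟩ j) (h ⟨i, hi⟩ j) using 1
    funext a
    simp [entryWeight, hi]
  · convert nearUniformWeight_uniform F hC using 1
    funext a
    simp [entryWeight, hi]

theorem map_corank_real_singleton (hm : ∀ i j, Measurable fun ω => M ω i j)
    (hind : iIndepFun (fun (p : Fin n × Fin n) ω => M ω p.1 p.2) μ) (d : ℕ) :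
    (μ.map fun ω => corank (M ω)).real {d} = nullityLaw (entryWeight μ M) n d := by
  classical
  have hpre : ∀ d, (fun ω => corank (M ω)) ⁻¹' {d} =
      M ⁻¹' ↑(Finset.univ.filter fun A : Matrix (Fin n) (Fin n) F => corank A = d) := by
    intro d; ext ω; simp
  have hmeas : Measurable fun ω => corank (M ω) := by
    refine measurable_to_countable' fun d => ?_
    rw [hpre, ← Set.biUnion_preimage_singleton]
    exact Finset.measurableSet_biUnion _ fun A _ => measurableSet_matrix_eq hm A
  rw [map_measureReal_apply hmeas (measurableSet_singleton d), hpre,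
    ← sum_measureReal_preimage_singleton _ fun A _ => measurableSet_matrix_eq hm A,
    Finset.sum_filter, nullityLaw, rowExp]
  refine Finset.sum_congr rfl fun A _ => ?_
  have h := rank_add_finrank_rowKer A
  have hc : corank A = Module.finrank F (rowKer A) := by rw [corank]; omega
  rw [hc, measureReal_matrix_eq hind]
  simp

/-- Triangle inequality through the law for a uniform matrix. The `1 / 2` in the total variation
distance cancels the factor 2 of the row-by-row estimate. -/
theorem tvDist_map_corank_le {C : ℝ} (hC : 1 ≤ C) (hm : ∀ i j, Measurable fun ω => M ω i j)
    (hind : iIndepFun (fun (p : Fin n × Fin n) ω => M ω p.1 p.2) μ)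
    (h : ∀ i j, IsNearUniform μ C fun ω => M ω i j) :
    tvDist (μ.map fun ω => corank (M ω))
        (limitCorankPMF (Fintype.card F) Fintype.one_lt_card).toMeasure ≤
      n * √(C ^ 3 / Fintype.card F) ^ n + 1 / 2 *
        ∑' d, |uniformNullityLaw (Fintype.card F : ℝ)⁻¹ n n d -
          limitCorankProb (Fintype.card F) d| := by
  have hq : 1 < Fintype.card F := Fintype.one_lt_card
  set v := nullityLaw (entryWeight μ M) n with hv
  set u := uniformNullityLaw (Fintype.card F : ℝ)⁻¹ n n with hu
  have hlim : ∀ d, (limitCorankPMF (Fintype.card F) hq).toMeasure.real {d} =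
      limitCorankProb (Fintype.card F) d := by
    intro d
    rw [measureReal_def, PMF.toMeasure_apply_singleton _ _ (measurableSet_singleton d)]
    exact ENNReal.toReal_ofReal (limitCorankProb_nonneg hq d)
  have hz : ∀ d ∉ Finset.range (n + 1), |v d - u d| = 0 := by
    intro d hd
    have hd : n < d := by simpa using hd
    have h1 : v d = 0 := by
      refine Finset.sum_eq_zero fun Y _ => ?_
      have : Module.finrank F (rowKer Y) ≤ n := by
        simpa using Submodule.finrank_le (rowKer Y)
      simp only [if_neg (show Module.finrank F (rowKer Y) ≠ d by omega), mul_zero]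
    rw [h1, hu, uniformNullityLaw_eq_zero_of_lt _ n hd, sub_zero, abs_zero]
  have hvu : HasSum (fun d => |v d - u d|) (∑ d ∈ Finset.range (n + 1), |v d - u d|) :=
    hasSum_sum_of_ne_finset_zero hz
  have hul : Summable fun d => |u d - limitCorankProb (Fintype.card F) d| :=
    ((hasSum_uniformNullityLaw _ n n).summable.sub (hasSum_limitCorankProb hq).summable).abs
  have htri : ∀ d, |v d - limitCorankProb (Fintype.card F) d| ≤
      |v d - u d| + |u d - limitCorankProb (Fintype.card F) d| := fun d => abs_sub_le _ _ _
  have hs := hvu.summable.add hul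
  have h1 := Summable.tsum_le_tsum htri
    (Summable.of_nonneg_of_le (fun d => abs_nonneg _) htri hs) hs
  rw [hvu.summable.tsum_add hul, hvu.tsum_eq] at h1
  have h2 := sum_abs_nullityLaw_sub_le hC (nearUniformWeight_entryWeight hC hm h) le_rfl
  simp only [tvDist, map_corank_real_singleton hm hind, hlim]
  linarith

end RandomMatrix

/-! ### Choice of constants and conclusion. -/

theorem theorem1p1 (C : ℝ) (hC : 1 ≤ C) :
    ∃ c C' : ℝ, 0 < c ∧ 0 < C' ∧
      ∀ (F : Type*) [Field F] [Fintype F] [MeasurableSpace F] [MeasurableSingletonClass F]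
        (n : ℕ) (Ω : Type*) [MeasurableSpace Ω] (μ : Measure Ω) [IsProbabilityMeasure μ]
        (M : Ω → Matrix (Fin n) (Fin n) F),
        (∀ i j, Measurable fun ω => M ω i j) →
        iIndepFun (fun (p : Fin n × Fin n) ω => M ω p.1 p.2) μ →
        (∀ i j, IsNearUniform μ C fun ω => M ω i j) →
        tvDist (μ.map fun ω => corank (M ω))
            (limitCorankPMF (Fintype.card F) Fintype.one_lt_card).toMeasure ≤
          (C' / (Fintype.card F : ℝ)) ^ (c * (n : ℝ)) := by
  -- With `s = √(C ^ 3 / q)` the total error is at most `(n + 64) * s ^ n`, and these constants make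
  -- the target equal to `(66 * s) ^ n`.
  refine ⟨1 / 2, 66 ^ 2 * C ^ 3, by norm_num, by positivity, ?_⟩
  intro F _ _ _ _ n Ω _ μ _ M hm hind h
  have hq : 1 < Fintype.card F := Fintype.one_lt_card
  have hq' : (1 : ℝ) < Fintype.card F := by exact_mod_cast hq
  have h0 : 0 < (Fintype.card F : ℝ)⁻¹ := by positivity
  have h1 : (Fintype.card F : ℝ)⁻¹ < 1 := inv_lt_one_of_one_lt₀ hq'
  refine (tvDist_map_corank_le hC hm hind h).trans ?_
  rcases Nat.eq_zero_or_pos n with rfl | hn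
  -- For `n = 0` the target is `1`, so the trivial bound on total variation is enough; it results
  -- from taking the limiting law itself as the error term.
  · have := tsum_abs_sub_le_of_sub_le (hasSum_uniformNullityLaw (Fintype.card F : ℝ)⁻¹ 0 0)
      (hasSum_limitCorankProb hq) (hasSum_limitCorankProb hq) (limitCorankProb_nonneg hq)
      fun d => sub_le_self _ (uniformNullityLaw_nonneg h0 h1 0 0 d)
    simp only [Nat.cast_zero, zero_mul, zero_add, mul_zero, Real.rpow_zero]
    linarith
  · have htail := tsum_abs_uniformNullityLaw_sub_limitCorankProb_le hq n
    set s : ℝ := √(C ^ 3 / Fintype.card F) with hs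
    have e : (66 ^ 2 * C ^ 3 / (Fintype.card F : ℝ)) ^ ((1 / 2 : ℝ) * (n : ℝ)) = (66 * s) ^ n := by
      rw [Real.rpow_mul (by positivity), ← Real.sqrt_eq_rpow, Real.rpow_natCast, mul_div_assoc,
        Real.sqrt_mul (by positivity), Real.sqrt_sq (by norm_num)]
    have hxs : (Fintype.card F : ℝ)⁻¹ ≤ s := by
      refine Real.le_sqrt_of_sq_le ?_
      rw [div_eq_mul_inv]
      have : 1 ≤ C ^ 3 := one_le_pow₀ hC
      nlinarith
    have hpow : ((Fintype.card F : ℝ)⁻¹) ^ n ≤ s ^ n := pow_le_pow_left₀ h0.le hxs n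
    -- Bernoulli gives `66 ^ n ≥ 1 + 65 n`, which is at least `n + 64` because `n ≥ 1`.
    have hn2 : (n : ℝ) + 64 ≤ 66 ^ n := by
      have := one_add_mul_le_pow (show (-2 : ℝ) ≤ 65 by norm_num) n
      have hn1 : (1 : ℝ) ≤ n := by exact_mod_cast hn
      norm_num at this
      linarith
    have hs0 : 0 ≤ s ^ n := by positivity
    rw [e, mul_pow]
    calc _ ≤ n * s ^ n + 64 * s ^ n := by linarith
      _ = (n + 64) * s ^ n := by ring
      _ ≤ _ := by gcongr
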